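/- \textbf{Conventions.} A \emph{represented space} is a set $X$ with a partial surjection $\rho:\subseteq\mathbb{N}^{\mathbb{N}}\to X$; $p$ is a \emph{name} of $\rho(p)$. A product $X\times Y$ is represented by interleaving names. A \emph{problem} $P:\subseteq X\rightrightarrows Y$ is a partial multi-function between represented spaces; it is \emph{continuously realizable} if some continuous partial $F:\subseteq\mathbb{N}^{\mathbb{N}}\to\mathbb{N}^{\mathbb{N}}$ sends every name of every $x\in\mathrm{dom}(P)$ to a name of an element of $P(x)$. Composition of multi-functions is taken with $\mathrm{dom}(Q\circ P)=\{x\in\mathrm{dom}(P) : P(x)\subseteq\mathrm{dom}(Q)\}$. For problems $P:\subseteq X\rightrightarrows Y$ and $Q:\subseteq Z\rightrightarrows W$, write $P\le_W Q$ if there are a represented space $V$ and continuously realizable $k:\subseteq X\rightrightarrows V\times Z$, $h:\subseteq V\times W\rightrightarrows Y$ such that for $R=h\circ(\mathrm{id}_V\times Q)\circ k$ one has $\mathrm{dom}(P)\subseteq\mathrm{dom}(R)$ and $R(x)\subseteq P(x)$ for all $x\in\mathrm{dom}(P)$; write $P\equiv_W Q$ if $P\le_W Q$ and $Q\le_W P$.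 A marked group, i.e. a group with a generating $k$-tuple ($k\ge1$) up to marked isomorphism, is identified with its set of relations, a normal subgroup of the free group $\mathbb{F}_k$. Fix bijections $\theta_k:\mathbb{N}\to\mathbb{F}_k$ ($k\ge 1$). $\mathcal{G}_{\mathrm{WP}}$ is the set $\mathcal{G}$ of marked groups where a name of $(G,S)$, $|S|=k$, is the sequence $u$ with $u_0=k$ and $(u_{i+1})_{i\ge0}\in\{0,1\}^{\mathbb{N}}$ the characteristic function of $\{i : \theta_k(i)=1\text{ in }G\}$. $\mathcal{G}_{\mathrm{Pres}}$ is $\mathcal{G}$ where $u$ with $u_0=k\ge1$ is a name of the group $\langle S\mid \theta_k(u_i),\, i\ge1\rangle$ with $|S|=k$. For a set $\mathcal{C}$ of finitely generated groups, $\mathrm{Res}_{\mathcal{C}}$ maps a marked group $G$ to its quotient, with the induced marking, by the intersection of the kernels of all homomorphisms from $G$ onto groups of $\mathcal{C}$. A group $G$ is residually-$\mathcal{C}$ if every $g\ne1$ in $G$ has non-trivial image in some quotient of $G$ that belongs to $\mathcal{C}$, and $\mathcal{RC}$ is the set of residually-$\mathcal{C}$ marked groups. $\mathcal{RC}$ is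 \emph{non-trivial} if it is neither the set of all marked groups nor the set of markings of the trivial group. \textbf{Lemma.} Let $\mathcal{C}$ be a set of finitely generated groups such that $\mathcal{RC}$ is non-trivial. Suppose moreover that there are a finitely generated group $H$ and an element $w\in H\setminus\{1\}$ which is killed by all homomorphisms, onto or not, from $H$ to groups of $\mathcal{C}$. (If $\mathcal{C}$ is closed under finitely generated subgroups, this follows from the non-triviality of $\mathcal{RC}$.) Then \[ \mathrm{Res}_{\mathcal{C}}:\mathcal{G}_{\mathrm{WP}}\to\mathcal{G}_{\mathrm{WP}}\quad\equiv_W\quad \mathrm{Res}_{\mathcal{C}}:\mathcal{G}_{\mathrm{Pres}}\to\mathcal{G}_{\mathrm{WP}}. \] -/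

import Mathlib

universe u v

/-! ### Represented spaces -/

/-- Baire space, with its product topology. -/
abbrev Baire : Type := ℕ → ℕ

/-- A represented space: a set `carrier` with a partial surjection from Baire space onto it. The
partial surjection is given by its graph: `IsName p x` says that `p` lies in its domain and is sent
to `x`, i.e. that `p` is a name of `x`. -/
structure RepresentedSpace where
  carrier : Type
  IsName : Baire → carrier → Prop
  functional : ∀ (p : Baire) (x y : carrier), IsName p x → IsName p y → x = y
  surjective : ∀ x : carrier, ∃ p : Baire, IsName p x

namespace RepresentedSpace

/-- The product of two represented spaces: a name of a pair `(x, y)` is a sequence whose even part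
is a name of `x` and whose odd part is a name of `y`. -/
def prod (X Y : RepresentedSpace) : RepresentedSpace where
  carrier := X.carrier × Y.carrier
  IsName p z := X.IsName (fun n => p (2 * n)) z.1 ∧ Y.IsName (fun n => p (2 * n + 1)) z.2
  functional := fun _ z z' h h' =>
    Prod.ext (X.functional _ z.1 z'.1 h.1 h'.1) (Y.functional _ z.2 z'.2 h.2 h'.2)
  surjective := by
    rintro ⟨x, y⟩
    obtain ⟨p, hp⟩ := X.surjective x
    obtain ⟨q, hq⟩ := Y.surjective y
    refine ⟨fun n => if n % 2 = 0 then p (n / 2) else q (n / 2), ?_, ?_⟩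
    · have h : (fun n : ℕ => if (2 * n) % 2 = 0 then p ((2 * n) / 2) else q ((2 * n) / 2)) = p := by
        funext n
        have h0 : (2 * n) % 2 = 0 := by omega
        have h1 : (2 * n) / 2 = n := by omega
        rw [if_pos h0, h1]
      simpa only [h] using hp
    · have h : (fun n : ℕ => if (2 * n + 1) % 2 = 0 then p ((2 * n + 1) / 2)
          else q ((2 * n + 1) / 2)) = q := by
        funext n
        have h0 : ¬ (2 * n + 1) % 2 = 0 := by omega
        have h1 : (2 * n + 1) / 2 = n := by omega
        rw [if_neg h0, h1]
      simpa only [h] using hq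

end RepresentedSpace

/-! ### Problems and continuous Weihrauch reduction -/

/-- A problem: a partial multi-function between represented spaces. -/
abbrev Problem (X Y : RepresentedSpace) : Type := X.carrier → Set Y.carrier

namespace Problem

variable {X Y Z W : RepresentedSpace}

/-- The domain of a partial multi-function. -/
def dom (P : Problem X Y) : Set X.carrier := {x | (P x).Nonempty}

/-- A (total) function, seen as a single valued problem. -/
def ofFun (f : X.carrier → Y.carrier) : Problem X Y := fun x => {f x}

/-- The identity problem. -/
def ident (X : RepresentedSpace) : Problem X X := fun x => {x}

/-- Composition `Q ∘ P` of partial multi-functions; its domain consists of those `x` in the domain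
of `P` for which every value of `P x` is in the domain of `Q`. -/
def comp (Q : Problem Y Z) (P : Problem X Y) : Problem X Z :=
  fun x => {z | P x ⊆ Q.dom ∧ ∃ y ∈ P x, z ∈ Q y}

/-- The product of two problems. -/
def prod (P : Problem X Y) (Q : Problem Z W) : Problem (X.prod Z) (Y.prod W) :=
  fun xz => P xz.1 ×ˢ Q xz.2

/-- `P` solves `Q`, written `P ⊑ Q`. -/
def Solves (P Q : Problem X Y) : Prop :=
  Q.dom ⊆ P.dom ∧ ∀ x ∈ Q.dom, P x ⊆ Q x

/-- The partial function on Baire space with domain `D` that agrees with `F` there is a realizer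
of `P`. -/
def IsRealizer (P : Problem X Y) (D : Set Baire) (F : Baire → Baire) : Prop :=
  ∀ (u : Baire) (x : X.carrier), X.IsName u x → x ∈ P.dom →
    u ∈ D ∧ ∃ y ∈ P x, Y.IsName (F u) y

/-- `P` has a realizer that is a continuous partial function on Baire space. -/
def ContinuouslyRealizable (P : Problem X Y) : Prop :=
  ∃ (D : Set Baire) (F : Baire → Baire), ContinuousOn F D ∧ P.IsRealizer D F

/-- Continuous Weihrauch reducibility `P ≤_W Q`, for `P` from `X` to `Y` and `Q` from `Z` to `W`. -/
def WeihrauchLE (P : Problem X Y) (Q : Problem Z W) : Prop :=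
  ∃ (V : RepresentedSpace) (h : Problem (V.prod W) Y) (k : Problem X (V.prod Z)),
    h.ContinuouslyRealizable ∧ k.ContinuouslyRealizable ∧
      Solves (h.comp (((ident V).prod Q).comp k)) P

/-- Continuous Weihrauch equivalence `P ≡_W Q`. -/
def WeihrauchEquiv (P : Problem X Y) (Q : Problem Z W) : Prop :=
  P.WeihrauchLE Q ∧ Q.WeihrauchLE P

end Problem

/-! ### Marked groups -/

/-- (Isomorphism classes of) marked groups. A finitely generated group marked by a generating
`k`-tuple is identified with its set of relations, a normal subgroup of the free group of
rank `k`. -/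
structure MarkedGroup where
  rank : ℕ+
  rel : Subgroup (FreeGroup (Fin rank))
  normal : rel.Normal

attribute [instance] MarkedGroup.normal

/-- The underlying group of a marked group (the marking is given by the images of the
generators of the free group). -/
abbrev MarkedGroup.group (G : MarkedGroup) : Type := FreeGroup (Fin G.rank) ⧸ G.rel

/-- The space of marked groups with the word problem representation: a name of `G` consists of the
rank of `G` followed by the characteristic function, with values in `{0, 1}`, of the set of relations
of `G`, where the elements of the free group of rank `k` are numbered by `θ k`. -/
def markedGroupsWP (θ : ∀ k : ℕ+, ℕ ≃ FreeGroup (Fin k)) : RepresentedSpace where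
  carrier := MarkedGroup
  IsName u G := u 0 = G.rank ∧ (∀ i, u (i + 1) = 0 ∨ u (i + 1) = 1) ∧
    (G.rel : Set (FreeGroup (Fin G.rank))) = {g | ∃ i, u (i + 1) = 1 ∧ θ G.rank i = g}
  functional := by
    rintro u ⟨k, N, hN⟩ ⟨l, M, hM⟩ ⟨h1, -, h2⟩ ⟨h3, -, h4⟩
    obtain rfl : k = l := PNat.coe_injective (h1.symm.trans h3)
    obtain rfl : N = M := SetLike.coe_injective (h2.trans h4.symm)
    rfl
  surjective := by
    classical
    intro G
    refine ⟨fun n => match n with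
      | 0 => G.rank
      | i + 1 => if θ G.rank i ∈ G.rel then 1 else 0, rfl, ?_, ?_⟩
    · intro i
      by_cases h : θ G.rank i ∈ G.rel <;> simp [h]
    · ext g
      constructor
      · intro hg
        refine ⟨(θ G.rank).symm g, ?_, by simp⟩
        have hg' : g ∈ G.rel := hg
        simp [hg']
      · rintro ⟨i, hi, rfl⟩
        by_contra h
        have h' : ¬ θ G.rank i ∈ G.rel := h
        simp [h'] at hi

/-- The set of marked groups with the presentation representation: a sequence `u` is a name of the
group presented by `u 0` generators and the relators `θ (u 0) (u i)`, `i ≥ 1`. -/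
def markedGroupsPres (θ : ∀ k : ℕ+, ℕ ≃ FreeGroup (Fin k)) : RepresentedSpace where
  carrier := MarkedGroup
  IsName u G := u 0 = G.rank ∧
    G.rel = Subgroup.normalClosure (Set.range fun i : ℕ => θ G.rank (u (i + 1)))
  functional := by
    rintro u ⟨k, N, hN⟩ ⟨l, M, hM⟩ ⟨h1, h2⟩ ⟨h3, h4⟩
    obtain rfl : k = l := PNat.coe_injective (h1.symm.trans h3)
    obtain rfl : N = M := h2.trans h4.symm
    rfl
  surjective := by
    classical
    intro G
    refine ⟨fun n => match n with
      | 0 => G.rank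
      | i + 1 => if θ G.rank i ∈ G.rel then i else (θ G.rank).symm 1, rfl, ?_⟩
    apply le_antisymm
    · intro g hg
      apply Subgroup.subset_normalClosure
      refine ⟨(θ G.rank).symm g, ?_⟩
      simp [hg]
    · apply Subgroup.normalClosure_le_normal
      rintro _ ⟨i, rfl⟩
      by_cases h : θ G.rank i ∈ G.rel
      · simp [h]
      · simp [h]

/-! ### Residually-`C` groups and the greatest residually-`C` quotient -/

section Residual

variable (C : Set GrpCat.{u})

/-- `G` is residually-`C`: every non-identity element of `G` has a non-identity image in some
quotient of `G` that is in `C`. -/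
def IsResidually (G : Type v) [Group G] : Prop :=
  ∀ g : G, g ≠ 1 → ∃ Q ∈ C, ∃ f : G →* Q, Function.Surjective f ∧ f g ≠ 1

/-- The intersection of the kernels of all homomorphisms from `G` onto groups of `C`. -/
def residualKernel (G : Type v) [Group G] : Subgroup G :=
  ⨅ Q ∈ C, ⨅ (f : G →* Q) (_ : Function.Surjective f), f.ker

instance residualKernel_normal (G : Type v) [Group G] : (residualKernel C G).Normal := by
  refine ⟨fun n hn g => ?_⟩
  simp only [residualKernel, Subgroup.mem_iInf] at hn ⊢
  intro Q hQ f hf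
  exact (MonoidHom.normal_ker f).conj_mem n (hn Q hQ f hf) g

/-- The greatest residually-`C` quotient of a marked group `G`, i.e. the quotient of `G` by
`residualKernel C G`, with the induced marking. -/
def residualImage (G : MarkedGroup) : MarkedGroup where
  rank := G.rank
  rel := (residualKernel C G.group).comap (QuotientGroup.mk' G.rel)
  normal := inferInstance

/-- The set of residually-`C` marked groups. -/
def residuallySet : Set MarkedGroup := {G | IsResidually C G.group}

/-- The set of residually-`C` marked groups is neither the set of all marked groups, nor reduced to
the trivial group. -/
def ResiduallyNontrivial : Prop :=
  residuallySet C ≠ Set.univ ∧ residuallySet C ≠ {G | Subsingleton G.group}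

end Residual

/-!
A quotient of a group `G` that lies in `C` is not changed by adjoining to `G` elements which every
homomorphism to a group of `C` must kill. A group given by a presentation can therefore be replaced,
before its greatest residually-`C` quotient is computed, by a larger group whose word problem is
known.

The first ingredient is a finitely generated group `T` which has no non-trivial homomorphism to any
group of `C` and contains free elements `t 0, t 1, …` (`exists_fg_killed_free`). It comes from
an embedding theorem: a finitely generated group `H` with an element `w ≠ 1` embeds in a finitely
generated group `L` in which `w` is a normal generator
(`exists_fg_embedding_normally_generated`), and this is applied to the product of the given group
with a free group. The group `L` consists of permutations of `(H → ℕ) × ℕ`. Killing `w` identifies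
each permutation of one coordinate of `H → ℕ` with the same permutation of another coordinate, hence
kills commutators of such permutations. One of these commutators makes the set of even numbers
paradoxical: this set is the disjoint union of two translates of itself. An element supported over a
paradoxical set is, modulo what is killed, equal to its own square, so it is killed
(`hullPerms_le`).

Given a presentation of `G` with free group `X` on the generators and relators `r 0, r 1, …`, two
copies of `X × T` are amalgamated along the free subgroups on the elements `(r i, t i)` of the first
copy and `(1, t i)` of the second one. Killing both copies of `T` imposes exactly the relations
`r i = 1`, so the subgroup generated by the first copy of `X` and both copies of `T` has the same
quotients in `C` as `G` (`firstGens_mem_residualImage_iff`). Membership in the amalgamated subgroups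
is decided by finitely many relators, because the component in `T` determines the only candidate
word. By the normal form theorem for amalgams, the triviality of a given element thus depends on
finitely many relators only (`eventually_toAmalgam_eq_one_iff`), that is, the word problem of the
amalgam is a continuous function of the presentation. The reduction in the other direction
enumerates the relations of a group from its word problem.
-/

/-! ### Permutations of a product acting on one coordinate -/

open Equiv in
/-- The permutation `g` of the first coordinate, performed over the points of `X` only. -/
noncomputable def permFst {U Z : Type*} (X : Set Z) : Perm U →* Perm (U × Z) where
  toFun g := by
    classical exact prodCongrLeft fun z => if z ∈ X then g else 1
  map_one' := by ext p : 1; simp [prodCongrLeft]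
  map_mul' g h := by
    ext p : 1
    by_cases hp : p.2 ∈ X <;> simp [prodCongrLeft, hp]

open Equiv in
/-- The permutation `t` of the second coordinate, performed over the points of `B` only. -/
noncomputable def permSnd {U Z : Type*} (B : Set U) : Perm Z →* Perm (U × Z) where
  toFun t := by
    classical exact prodCongrRight fun u => if u ∈ B then t else 1
  map_one' := by ext p : 1; simp [prodCongrRight]
  map_mul' g h := by
    ext p : 1
    by_cases hp : p.1 ∈ B <;> simp [prodCongrRight, hp]

section PermProd

open Equiv

variable {U Z : Type*}

lemma permFst_apply_of_mem {X : Set Z} (g : Perm U) (u : U) {z : Z} (hz : z ∈ X) :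
    permFst X g (u, z) = (g u, z) := by
  simp [permFst, hz]

lemma permFst_apply_of_notMem {X : Set Z} (g : Perm U) (u : U) {z : Z} (hz : z ∉ X) :
    permFst X g (u, z) = (u, z) := by
  simp [permFst, hz]

lemma permSnd_apply_of_mem {B : Set U} (t : Perm Z) {u : U} (z : Z) (hu : u ∈ B) :
    permSnd B t (u, z) = (u, t z) := by
  simp [permSnd, hu]

lemma permSnd_apply_of_notMem {B : Set U} (t : Perm Z) {u : U} (z : Z) (hu : u ∉ B) :
    permSnd B t (u, z) = (u, z) := by
  simp [permSnd, hu]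

lemma permFst_union {X Y : Set Z} (h : Disjoint X Y) (g : Perm U) :
    permFst (X ∪ Y) g = permFst X g * permFst Y g := by
  ext ⟨u, z⟩ : 1
  rw [Perm.mul_apply]
  by_cases hX : z ∈ X
  · rw [permFst_apply_of_notMem g u (Set.disjoint_left.1 h hX), permFst_apply_of_mem g u hX,
      permFst_apply_of_mem g u (Set.mem_union_left Y hX)]
  · by_cases hY : z ∈ Y
    · rw [permFst_apply_of_mem g u hY, permFst_apply_of_notMem g _ hX,
        permFst_apply_of_mem g u (Set.mem_union_right X hY)]
    · rw [permFst_apply_of_notMem g u hY, permFst_apply_of_notMem g _ hX,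
        permFst_apply_of_notMem g u (by simp [hX, hY])]

lemma permSnd_union {B C : Set U} (h : Disjoint B C) (t : Perm Z) :
    permSnd (B ∪ C) t = permSnd B t * permSnd C t := by
  ext ⟨u, z⟩ : 1
  rw [Perm.mul_apply]
  by_cases hB : u ∈ B
  · rw [permSnd_apply_of_notMem t z (Set.disjoint_left.1 h hB), permSnd_apply_of_mem t z hB,
      permSnd_apply_of_mem t z (Set.mem_union_left C hB)]
  · by_cases hC : u ∈ C
    · rw [permSnd_apply_of_mem t z hC, permSnd_apply_of_notMem t _ hB,
        permSnd_apply_of_mem t z (Set.mem_union_right B hC)]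
    · rw [permSnd_apply_of_notMem t z hC, permSnd_apply_of_notMem t _ hB,
        permSnd_apply_of_notMem t z (by simp [hB, hC])]

/-- Conjugating by a permutation of the whole second coordinate moves the set over which the first
coordinate is permuted. -/
lemma permSnd_univ_conj_permFst (t : Perm Z) (X : Set Z) (g : Perm U) :
    permSnd Set.univ t * permFst X g * (permSnd Set.univ t)⁻¹ = permFst (t '' X) g := by
  rw [mul_inv_eq_iff_eq_mul]
  ext ⟨u, z⟩ : 1
  rw [Perm.mul_apply, Perm.mul_apply, permSnd_apply_of_mem t z (Set.mem_univ u)]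
  by_cases hz : z ∈ X
  · rw [permFst_apply_of_mem g u hz, permFst_apply_of_mem g u (Set.mem_image_of_mem t hz),
      permSnd_apply_of_mem t z (Set.mem_univ _)]
  · rw [permFst_apply_of_notMem g u hz, permFst_apply_of_notMem g u (by simpa using hz),
      permSnd_apply_of_mem t z (Set.mem_univ _)]

/-- Conjugating by a permutation of the whole first coordinate moves the set over which the second
coordinate is permuted. -/
lemma permFst_univ_conj_permSnd (g : Perm U) (B : Set U) (t : Perm Z) :
    permFst Set.univ g * permSnd B t * (permFst Set.univ g)⁻¹ = permSnd (g '' B) t := by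
  rw [mul_inv_eq_iff_eq_mul]
  ext ⟨u, z⟩ : 1
  rw [Perm.mul_apply, Perm.mul_apply, permFst_apply_of_mem g u (Set.mem_univ z)]
  by_cases hu : u ∈ B
  · rw [permSnd_apply_of_mem t z hu, permSnd_apply_of_mem t z (Set.mem_image_of_mem g hu),
      permFst_apply_of_mem g u (Set.mem_univ _)]
  · rw [permSnd_apply_of_notMem t z hu, permSnd_apply_of_notMem t z (by simpa using hu),
      permFst_apply_of_mem g u (Set.mem_univ _)]

lemma permFst_univ_injective [Nonempty Z] :
    Function.Injective (permFst (Set.univ : Set Z) : Perm U →* Perm (U × Z)) := by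
  intro g h hgh
  obtain ⟨z⟩ := ‹Nonempty Z›
  ext u
  have := congrArg (fun p : Perm (U × Z) => (p (u, z)).1) hgh
  simpa [permFst_apply_of_mem _ _ (Set.mem_univ z)] using this

end PermProd

/-! ### Three permutations of the natural numbers -/

section NatPerm

open Equiv

/-- The permutation of `ℕ` exchanging `2 n` and `2 n + 1`. -/
def swapTwo : Perm ℕ where
  toFun n := if n % 2 = 0 then n + 1 else n - 1
  invFun n := if n % 2 = 0 then n + 1 else n - 1
  left_inv n := by dsimp only; split_ifs <;> omega
  right_inv n := by dsimp only; split_ifs <;> omega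

/-- The permutation of `ℕ` exchanging `4 n` and `4 n + 2` and fixing the odd numbers. -/
def swapFour : Perm ℕ where
  toFun n := if n % 4 = 0 then n + 2 else if n % 4 = 2 then n - 2 else n
  invFun n := if n % 4 = 0 then n + 2 else if n % 4 = 2 then n - 2 else n
  left_inv n := by dsimp only; split_ifs <;> omega
  right_inv n := by dsimp only; split_ifs <;> omega

/-- The permutation of `ℕ` sending `4 n`, `4 n + 1`, `4 n + 2`, `4 n + 3` to `2 n + 1`, `4 n`,
`8 n + 2`, `8 n + 6`, so that the conjugate by it of `swapTwo` exchanges `2 n + 1` and `4 n`. -/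
def oddSpread : Perm ℕ where
  toFun n := if n % 4 = 0 then n / 2 + 1 else if n % 4 = 1 then n - 1
    else if n % 4 = 2 then 2 * n - 2 else 2 * n
  invFun n := if n % 2 = 1 then 2 * n - 2 else if n % 4 = 0 then n + 1
    else if n % 8 = 2 then (n + 2) / 2 else n / 2
  left_inv n := by dsimp only; split_ifs <;> omega
  right_inv n := by dsimp only; split_ifs <;> omega

/-- The commutator of `oddSpread` and `swapTwo`; it maps the even numbers onto the multiples
of `4`. -/
def evenShrink : Perm ℕ := oddSpread * swapTwo * oddSpread⁻¹ * swapTwo⁻¹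

lemma evenShrink_image : evenShrink '' {n | n % 2 = 0} = {n | n % 4 = 0} := by
  have key : ∀ m, evenShrink (2 * m) = 4 * m := by
    intro m
    have h1 : swapTwo⁻¹ (2 * m) = 2 * m + 1 := by
      rw [Perm.inv_eq_iff_eq]; simp [swapTwo]
    have h2 : oddSpread⁻¹ (2 * m + 1) = 4 * m := by
      rw [Perm.inv_eq_iff_eq]; simp [oddSpread]; omega
    have h3 : swapTwo (4 * m) = 4 * m + 1 := by simp [swapTwo]; omega
    have h4 : oddSpread (4 * m + 1) = 4 * m := by
      simp only [oddSpread, coe_fn_mk]; split_ifs <;> omega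
    rw [evenShrink, Perm.mul_apply, Perm.mul_apply, Perm.mul_apply, h1, h2, h3, h4]
  ext n
  constructor
  · rintro ⟨k, hk, rfl⟩
    obtain ⟨m, rfl⟩ : ∃ m, k = 2 * m := ⟨k / 2, by simp only [Set.mem_ofPred_eq] at hk; omega⟩
    simp [key]
  · intro hn
    simp only [Set.mem_ofPred_eq] at hn
    exact ⟨2 * (n / 4), by simp, by rw [key]; omega⟩

lemma swapTwo_image : swapTwo '' {n | n % 2 = 0} = {n | n % 2 = 1} := by
  ext n
  rw [Equiv.image_eq_preimage_symm]
  simp only [swapTwo, Set.mem_preimage, Set.mem_ofPred_eq, coe_fn_symm_mk]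
  split_ifs <;> omega

lemma swapFour_image_even : swapFour '' {n | n % 2 = 0} = {n | n % 2 = 0} := by
  ext n
  rw [Equiv.image_eq_preimage_symm]
  simp only [swapFour, Set.mem_preimage, Set.mem_ofPred_eq, coe_fn_symm_mk]
  split_ifs <;> omega

lemma swapFour_image_four : swapFour '' {n | n % 4 = 0} = {n | n % 4 = 2} := by
  ext n
  rw [Equiv.image_eq_preimage_symm]
  simp only [swapFour, Set.mem_preimage, Set.mem_ofPred_eq, coe_fn_symm_mk]
  split_ifs <;> omega

end NatPerm

/-! ### Embedding into a group normally generated by a given element -/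

section NormalGeneration

/-- If a subgroup `N` normalized by `L` contains `x`, then modulo `N` the element `b` equals its
conjugate by `x`; if the latter commutes with `a`, the commutator of `a` and `b` is in `N`. -/
lemma commutator_mem_of_commute_conj {G : Type*} [Group G] {L N : Subgroup G}
    (hN : ∀ g ∈ L, ∀ n ∈ N, g * n * g⁻¹ ∈ N) {a b x : G} (ha : a ∈ L) (hb : b ∈ L) (hx : x ∈ N)
    (h : Commute a (x * b * x⁻¹)) : a * b * a⁻¹ * b⁻¹ ∈ N := by
  set n := x * (b * x⁻¹ * b⁻¹) with hn
  have hnN : n ∈ N := N.mul_mem hx (hN b hb _ (N.inv_mem hx))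
  have hc : x * b * x⁻¹ = n * b := by rw [hn]; group
  have h' : a * (n * b) * a⁻¹ = n * b := by
    rw [← hc, h.eq]; group
  have : a * b * a⁻¹ * b⁻¹ = (a * n⁻¹ * a⁻¹) * n := by
    calc a * b * a⁻¹ * b⁻¹ = (a * n⁻¹ * a⁻¹) * (a * (n * b) * a⁻¹) * b⁻¹ := by group
      _ = (a * n⁻¹ * a⁻¹) * n := by rw [h']; group
  rw [this]
  exact N.mul_mem (hN a ha _ (N.inv_mem hnN)) hnN

/-- If modulo `N` the element `x` is the product of two elements both equal to `x`,
then `x` is in `N`. -/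
lemma mem_of_eq_mul_conj {G : Type*} [Group G] {L N : Subgroup G}
    (hN : ∀ g ∈ L, ∀ n ∈ N, g * n * g⁻¹ ∈ N) {x y c s : G} (hx : x ∈ L) (hc : c ∈ N) (hs : s ∈ L)
    (hcx : c * x * c⁻¹ = y) (hsx : s * x * s⁻¹ = x) (h : x = y * (s * y * s⁻¹)) : x ∈ N := by
  have h1 : y * x⁻¹ ∈ N := by
    have : y * x⁻¹ = c * (x * c⁻¹ * x⁻¹) := by rw [← hcx]; group
    rw [this]
    exact N.mul_mem hc (hN x hx _ (N.inv_mem hc))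
  have h2 : (s * y * s⁻¹) * x⁻¹ ∈ N := by
    have : (s * y * s⁻¹) * x⁻¹ = s * (y * x⁻¹) * s⁻¹ := by
      conv_lhs => rw [← hsx]
      group
    rw [this]
    exact hN s hs _ h1
  have h3 : x = (y * x⁻¹)⁻¹ * ((s * y * s⁻¹) * x⁻¹)⁻¹ := by
    have : x * (s * y * s⁻¹)⁻¹ = y := by
      rw [mul_inv_eq_iff_eq_mul]; exact h
    calc x = x * y⁻¹ * y := by group
      _ = (y * x⁻¹)⁻¹ * (x * (s * y * s⁻¹)⁻¹) := by rw [this]; group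
      _ = _ := by group
  rw [h3]
  exact N.mul_mem (N.inv_mem h1) (N.inv_mem h2)

open Equiv

variable (H : Type*) [Group H]

/-- The shift action of `H` on sequences of natural numbers indexed by `H`. -/
def shiftPerm : H →* Perm (H → ℕ) where
  toFun h :=
    { toFun := fun ω x => ω (h⁻¹ * x)
      invFun := fun ω x => ω (h * x)
      left_inv := fun ω => by simp
      right_inv := fun ω => by simp }
  map_one' := by ext; simp
  map_mul' g h := by ext; simp [mul_assoc]

/-- A permutation of `ℕ` acting on the coordinate at `1 : H` of a sequence indexed by `H`. -/
noncomputable def coordPerm : Perm ℕ →* Perm (H → ℕ) where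
  toFun t := by
    classical exact
    { toFun := fun ω x => if x = 1 then t (ω x) else ω x
      invFun := fun ω x => if x = 1 then t.symm (ω x) else ω x
      left_inv := fun ω => by ext x; by_cases hx : x = 1 <;> simp [hx]
      right_inv := fun ω => by ext x; by_cases hx : x = 1 <;> simp [hx] }
  map_one' := by ext; simp
  map_mul' s t := by ext ω x; by_cases hx : x = 1 <;> simp [hx]

variable {H}

lemma shiftPerm_injective : Function.Injective (shiftPerm H) := by
  classical
  intro g h hgh
  have := congrArg (fun p : Perm (H → ℕ) => p (Pi.single 1 1) h) hgh
  by_contra hne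
  have hne' : g⁻¹ * h ≠ 1 := by rwa [ne_eq, inv_mul_eq_one]
  simp [shiftPerm, hne'] at this

lemma coordPerm_apply_one (t : Perm ℕ) (ω : H → ℕ) : coordPerm H t ω 1 = t (ω 1) := by
  simp [coordPerm]

lemma coordPerm_image (t : Perm ℕ) (A : Set ℕ) :
    coordPerm H t '' {ω | ω 1 ∈ A} = {ω | ω 1 ∈ t '' A} := by
  ext ω
  constructor
  · rintro ⟨ω, hω, rfl⟩
    exact ⟨ω 1, hω, (coordPerm_apply_one t ω).symm⟩
  · intro hω
    refine ⟨(coordPerm H t)⁻¹ ω, ?_, by simp⟩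
    have h : (coordPerm H t)⁻¹ ω 1 = t⁻¹ (ω 1) := by
      rw [← map_inv]; exact coordPerm_apply_one _ _
    obtain ⟨n, hn, hn'⟩ := hω
    have h' : t⁻¹ (ω 1) = n := by rw [Perm.inv_eq_iff_eq, hn']
    simpa only [Set.mem_ofPred_eq, h, h'] using hn

/-- A permutation of the coordinate at `1` commutes with one of the coordinate at `w ≠ 1`. -/
lemma commute_coordPerm {w : H} (hw : w ≠ 1) (s t : Perm ℕ) :
    Commute (coordPerm H s) (shiftPerm H w * coordPerm H t * (shiftPerm H w)⁻¹) := by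
  classical
  have h : ∀ ω x, (shiftPerm H w * coordPerm H t * (shiftPerm H w)⁻¹) ω x =
      if x = w then t (ω x) else ω x := by
    intro ω x
    by_cases hx : x = w
    · subst hx
      simp [shiftPerm, coordPerm]
    · have : w⁻¹ * x ≠ 1 := by rw [ne_eq, inv_mul_eq_one]; exact fun h => hx h.symm
      simp [shiftPerm, coordPerm, hx, this]
  have h' : ∀ ω x, coordPerm H s ω x = if x = 1 then s (ω x) else ω x := by
    intro ω x; simp [coordPerm]
  ext ω x
  change coordPerm H s ((shiftPerm H w * coordPerm H t * (shiftPerm H w)⁻¹) ω) x =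
    (shiftPerm H w * coordPerm H t * (shiftPerm H w)⁻¹) (coordPerm H s ω) x
  rw [h, h', h', h]
  by_cases hx : x = w
  · subst hx; simp [hw]
  · simp [hx]

/-- The subgroup of `Perm ℕ` generated by three permutations for which the even numbers are a
paradoxical set. -/
def natPerms : Subgroup (Perm ℕ) := Subgroup.closure {oddSpread, swapTwo, swapFour}

lemma oddSpread_mem : oddSpread ∈ natPerms := Subgroup.subset_closure (by simp)
lemma swapTwo_mem : swapTwo ∈ natPerms := Subgroup.subset_closure (by simp)
lemma swapFour_mem : swapFour ∈ natPerms := Subgroup.subset_closure (by simp)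

lemma evenShrink_mem : evenShrink ∈ natPerms :=
  mul_mem (mul_mem (mul_mem oddSpread_mem swapTwo_mem) (inv_mem oddSpread_mem))
    (inv_mem swapTwo_mem)

lemma Subgroup.FG.map_hom {G K : Type*} [Group G] [Group K] {P : Subgroup G} (h : P.FG)
    (f : G →* K) : (P.map f).FG :=
  (Subgroup.fg_iff_submonoid_fg _).2 (((Subgroup.fg_iff_submonoid_fg P).1 h).map f)

lemma natPerms_fg : natPerms.FG := (Subgroup.fg_iff _).2 ⟨_, rfl, by simp⟩

variable (H)

/-- The permutations of `H → ℕ` generated by the shifts and by the permutations of the coordinate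
at `1` belonging to `natPerms`. -/
noncomputable def seqPerms : Subgroup (Perm (H → ℕ)) :=
  (shiftPerm H).range ⊔ natPerms.map (coordPerm H)

/-- The finitely generated group of permutations of `(H → ℕ) × ℕ` in which `H` embeds, and in which
every non-trivial element of `H` is a normal generator. -/
noncomputable def hullPerms : Subgroup (Perm ((H → ℕ) × ℕ)) :=
  (seqPerms H).map (permFst {n | n % 2 = 0}) ⊔
    (natPerms.map (permSnd {ω | ω 1 ∈ {n : ℕ | n % 2 = 0}}) ⊔ natPerms.map (permSnd Set.univ))

variable {H}

lemma hullPerms_fg [Group.FG H] : (hullPerms H).FG := by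
  have : (seqPerms H).FG := by
    refine Subgroup.FG.sup ?_ (natPerms_fg.map_hom _)
    rw [MonoidHom.range_eq_map]
    exact Group.FG.out.map_hom _
  exact Subgroup.FG.sup (this.map_hom _)
    (Subgroup.FG.sup (natPerms_fg.map_hom _) (natPerms_fg.map_hom _))

lemma permFst_even_mem {g : Perm (H → ℕ)} (hg : g ∈ seqPerms H) :
    permFst {n | n % 2 = 0} g ∈ hullPerms H :=
  Subgroup.mem_sup_left (Subgroup.mem_map_of_mem _ hg)

lemma permSnd_even_mem {t : Perm ℕ} (ht : t ∈ natPerms) :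
    permSnd {ω : H → ℕ | ω 1 ∈ {n : ℕ | n % 2 = 0}} t ∈ hullPerms H :=
  Subgroup.mem_sup_right (Subgroup.mem_sup_left (Subgroup.mem_map_of_mem _ ht))

lemma permSnd_univ_mem {t : Perm ℕ} (ht : t ∈ natPerms) :
    permSnd (Set.univ : Set (H → ℕ)) t ∈ hullPerms H :=
  Subgroup.mem_sup_right (Subgroup.mem_sup_right (Subgroup.mem_map_of_mem _ ht))

lemma even_union_odd : ({n | n % 2 = 0} ∪ {n | n % 2 = 1} : Set ℕ) = Set.univ := by
  ext n; simp only [Set.mem_union, Set.mem_ofPred_eq, Set.mem_univ, iff_true]; omega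

lemma disjoint_even_odd : Disjoint ({n | n % 2 = 0} : Set ℕ) {n | n % 2 = 1} :=
  Set.disjoint_left.2 fun n hn hn' => by simp only [Set.mem_ofPred_eq] at hn hn'; omega

lemma four_union_four : ({n | n % 4 = 0} ∪ {n | n % 4 = 2} : Set ℕ) = {n | n % 2 = 0} := by
  ext n; simp only [Set.mem_union, Set.mem_ofPred_eq]; omega

lemma disjoint_four_four : Disjoint ({n | n % 4 = 0} : Set ℕ) {n | n % 4 = 2} :=
  Set.disjoint_left.2 fun n hn hn' => by simp only [Set.mem_ofPred_eq] at hn hn'; omega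

lemma permFst_univ_eq {U : Type*} (g : Perm U) :
    permFst (Set.univ : Set ℕ) g = permFst {n | n % 2 = 0} g *
      (permSnd Set.univ swapTwo * permFst {n | n % 2 = 0} g * (permSnd Set.univ swapTwo)⁻¹) := by
  rw [permSnd_univ_conj_permFst, swapTwo_image, ← permFst_union disjoint_even_odd, even_union_odd]

lemma permFst_univ_mem {g : Perm (H → ℕ)} (hg : g ∈ seqPerms H) :
    permFst (Set.univ : Set ℕ) g ∈ hullPerms H := by
  rw [permFst_univ_eq]
  exact mul_mem (permFst_even_mem hg) (mul_mem (mul_mem (permSnd_univ_mem swapTwo_mem)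
    (permFst_even_mem hg)) (inv_mem (permSnd_univ_mem swapTwo_mem)))

lemma shiftPerm_mem (h : H) : shiftPerm H h ∈ seqPerms H :=
  Subgroup.mem_sup_left ⟨h, rfl⟩

lemma coordPerm_mem {t : Perm ℕ} (ht : t ∈ natPerms) : coordPerm H t ∈ seqPerms H :=
  Subgroup.mem_sup_right (Subgroup.mem_map_of_mem _ ht)

lemma permSnd_univ_eq (t : Perm ℕ) :
    permSnd (Set.univ : Set (H → ℕ)) t = permSnd {ω | ω 1 ∈ {n : ℕ | n % 2 = 0}} t *
      (permFst Set.univ (coordPerm H swapTwo) * permSnd {ω | ω 1 ∈ {n : ℕ | n % 2 = 0}} t *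
        (permFst Set.univ (coordPerm H swapTwo))⁻¹) := by
  rw [permFst_univ_conj_permSnd, coordPerm_image, swapTwo_image, ← permSnd_union]
  · congr 2
    ext ω
    have := Set.ext_iff.1 even_union_odd (ω 1)
    simpa using this
  · exact Set.disjoint_left.2 fun ω h h' => Set.disjoint_left.1 disjoint_even_odd h h'

/-- Every subgroup normalized by `hullPerms H` and containing the image of a non-trivial element of
`H` contains `hullPerms H`. The set of even numbers is the disjoint union of two translates of
itself, so an element supported over it is killed as soon as it is conjugate to its restrictions to
these translates by elements that are killed. -/
theorem hullPerms_le {w : H} (hw : w ≠ 1) {N : Subgroup (Perm ((H → ℕ) × ℕ))}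
    (hN : ∀ g ∈ hullPerms H, ∀ n ∈ N, g * n * g⁻¹ ∈ N)
    (hwN : permFst Set.univ (shiftPerm H w) ∈ N) : hullPerms H ≤ N := by
  -- Conjugation by `w` moves the coordinate at `1` to the one at `w`, whose permutations commute
  -- with those of the former; so the commutator `evenShrink` at the coordinate `1` is killed.
  have hshrink : permFst Set.univ (coordPerm H evenShrink) ∈ N := by
    have := commutator_mem_of_commute_conj hN
      (permFst_univ_mem (coordPerm_mem oddSpread_mem))
      (permFst_univ_mem (coordPerm_mem swapTwo_mem)) hwN
      (by simpa only [map_mul, map_inv] using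
        (commute_coordPerm hw oddSpread swapTwo).map (permFst Set.univ))
    simpa only [evenShrink, map_mul, map_inv] using this
  -- The sequences with even value at `1` are the disjoint union of the images of this set by
  -- `evenShrink` and by `swapFour * evenShrink` at the coordinate `1`.
  have hsnd : ∀ t ∈ natPerms, permSnd {ω : H → ℕ | ω 1 ∈ {n : ℕ | n % 2 = 0}} t ∈ N := by
    intro t ht
    refine mem_of_eq_mul_conj hN (permSnd_even_mem ht) hshrink
      (permFst_univ_mem (coordPerm_mem swapFour_mem))
      (permFst_univ_conj_permSnd _ _ _) ?_ ?_
    · rw [permFst_univ_conj_permSnd, coordPerm_image, swapFour_image_even]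
    · rw [permFst_univ_conj_permSnd, coordPerm_image, coordPerm_image, evenShrink_image,
        swapFour_image_four, ← permSnd_union]
      · congr 2
        ext ω
        have := Set.ext_iff.1 four_union_four (ω 1)
        simpa using this.symm
      · exact Set.disjoint_left.2 fun ω h h' => Set.disjoint_left.1 disjoint_four_four h h'
  have huniv : ∀ t ∈ natPerms, permSnd (Set.univ : Set (H → ℕ)) t ∈ N := by
    intro t ht
    rw [permSnd_univ_eq]
    exact mul_mem (hsnd t ht) (hN _ (permFst_univ_mem (coordPerm_mem swapTwo_mem)) _ (hsnd t ht))
  -- The same argument for the second coordinate, where `evenShrink` is now known to be killed.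
  have hfst : ∀ g ∈ seqPerms H, permFst {n | n % 2 = 0} g ∈ N := by
    intro g hg
    refine mem_of_eq_mul_conj hN (permFst_even_mem hg) (huniv _ evenShrink_mem)
      (permSnd_univ_mem swapFour_mem) (permSnd_univ_conj_permFst _ _ _) ?_ ?_
    · rw [permSnd_univ_conj_permFst, swapFour_image_even]
    · rw [permSnd_univ_conj_permFst, evenShrink_image, swapFour_image_four,
        ← permFst_union disjoint_four_four, four_union_four]
  refine sup_le ?_ (sup_le ?_ ?_) <;> rintro _ ⟨x, hx, rfl⟩
  exacts [hfst x hx, hsnd x hx, huniv x hx]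

/-- A finitely generated group with a non-trivial element `w` embeds in a finitely generated group
all of whose homomorphisms killing `w` are trivial. -/
theorem exists_fg_embedding_normally_generated (H : Type) [Group H] [Group.FG H] {w : H}
    (hw : w ≠ 1) : ∃ (L : Type) (_ : Group L) (_ : Group.FG L) (j : H →* L),
      Function.Injective j ∧
        ∀ (Q : Type u) [Group Q] (f : L →* Q), f (j w) = 1 → ∀ x, f x = 1 := by
  refine ⟨hullPerms H, inferInstance, (Group.fg_iff_subgroup_fg _).2 hullPerms_fg,
    ((permFst Set.univ).comp (shiftPerm H)).codRestrict _
      fun h => permFst_univ_mem (shiftPerm_mem h), ?_, ?_⟩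
  · intro g h hgh
    exact shiftPerm_injective (permFst_univ_injective (congrArg Subtype.val hgh))
  · intro Q _ f hf x
    have hle : hullPerms H ≤ f.ker.map (hullPerms H).subtype := by
      refine hullPerms_le hw ?_ ⟨_, hf, rfl⟩
      rintro g hg _ ⟨n, hn, rfl⟩
      exact ⟨⟨g, hg⟩ * n * ⟨g, hg⟩⁻¹, (MonoidHom.normal_ker f).conj_mem n hn _, rfl⟩
    obtain ⟨y, hy, hyx⟩ := hle x.2
    rwa [← Subtype.ext hyx]

end NormalGeneration

/-! ### A free subgroup of infinite rank -/

/-- The elements `x ^ n * y * x ^ (-n)` of the free group on `x` and `y` are free generators. To see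
this, `x` is made to act on the free group on `ℤ` by translation of the generators. -/
theorem lift_conj_pow_injective : Function.Injective (FreeGroup.lift fun n : ℕ =>
    (FreeGroup.of 0 ^ n * FreeGroup.of 1 * (FreeGroup.of 0 ^ n)⁻¹ : FreeGroup (Fin 2))) := by
  let a : MulAut (FreeGroup ℤ) := FreeGroup.freeGroupCongr (Equiv.addRight 1)
  let φ : Multiplicative ℤ →* MulAut (FreeGroup ℤ) := zpowersHom _ a
  have ha : ∀ n : ℕ, φ (Multiplicative.ofAdd 1 ^ n) (FreeGroup.of 0) = FreeGroup.of (n : ℤ) := by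
    intro n
    have h1 : φ (Multiplicative.ofAdd 1) = a := by simp [φ]
    rw [map_pow, h1]
    induction n with
    | zero => simp
    | succ n ih =>
      rw [pow_succ', MulAut.mul_apply, ih]
      simp [a]
  let F : FreeGroup (Fin 2) →* FreeGroup ℤ ⋊[φ] Multiplicative ℤ :=
    FreeGroup.lift ![SemidirectProduct.inr (Multiplicative.ofAdd 1),
      SemidirectProduct.inl (FreeGroup.of 0)]
  have hF : F.comp (FreeGroup.lift fun n : ℕ =>
      (FreeGroup.of 0 ^ n * FreeGroup.of 1 * (FreeGroup.of 0 ^ n)⁻¹ : FreeGroup (Fin 2))) =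
      SemidirectProduct.inl.comp (FreeGroup.map fun n : ℕ => (n : ℤ)) := by
    ext n : 1
    simp only [MonoidHom.comp_apply, FreeGroup.lift_apply_of, FreeGroup.map.of, map_mul, map_inv,
      map_pow, F]
    rw [← ha, SemidirectProduct.inl_aut]
    simp
  have hinj : Function.Injective (F.comp (FreeGroup.lift fun n : ℕ =>
      (FreeGroup.of 0 ^ n * FreeGroup.of 1 * (FreeGroup.of 0 ^ n)⁻¹ : FreeGroup (Fin 2)))) := by
    rw [hF]
    exact SemidirectProduct.inl_injective.comp
      (FreeGroup.map_injective Nat.cast_injective)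
  exact Function.Injective.of_comp hinj

/-- If some finitely generated group has a non-trivial element killed by all homomorphisms to groups
of `C`, then some finitely generated group has no non-trivial homomorphism to a group of `C` at all,
and contains a free subgroup of infinite rank. -/
theorem exists_fg_killed_free (C : Set GrpCat.{u}) (H : Type) [Group H] [Group.FG H] {w : H}
    (hw : w ≠ 1) (hC : ∀ Q ∈ C, ∀ f : H →* Q, f w = 1) :
    ∃ (T : Type) (_ : Group T) (_ : Group.FG T) (t : FreeGroup ℕ →* T), Function.Injective t ∧
      ∀ Q ∈ C, ∀ (f : T →* Q) (x : T), f x = 1 := by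
  have hw' : ((w, 1) : H × FreeGroup (Fin 2)) ≠ 1 := fun h => hw (congrArg Prod.fst h)
  obtain ⟨T, _, hT, j, hj, hkill⟩ :=
    exists_fg_embedding_normally_generated.{u} (H × FreeGroup (Fin 2)) hw'
  refine ⟨T, _, hT, (j.comp (MonoidHom.inr H _)).comp (FreeGroup.lift fun n : ℕ =>
    FreeGroup.of 0 ^ n * FreeGroup.of 1 * (FreeGroup.of 0 ^ n)⁻¹),
    (hj.comp fun a b h => congrArg Prod.snd h).comp lift_conj_pow_injective, ?_⟩
  intro Q hQ f
  exact hkill Q f (hC Q hQ ((f.comp j).comp (MonoidHom.inl H _)))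

/-! ### The amalgam attached to a sequence of relators -/

section Amalgam

open Monoid Filter

variable {X T : Type*} [Group X] [Group T]

/-- The two homomorphisms from the free group on `ℕ` to `X × T` along which two copies of `X × T`
are amalgamated: the `i`-th generator is sent to `(r i, t i)` and to `(1, t i)`, so that `r i` is
identified with an element of the normal closure of the two copies of `T`. -/
def amalgamLegs (r : FreeGroup ℕ →* X) (t : FreeGroup ℕ →* T) : Bool → FreeGroup ℕ →* X × T
  | false => r.prod t
  | true => (1 : FreeGroup ℕ →* X).prod t

/-- The inclusions of the two copies of `X × T` in their free product. -/
def copyIncl (X T : Type*) [Group X] [Group T] (b : Bool) :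
    X × T →* CoprodI (fun _ : Bool => X × T) :=
  CoprodI.of (M := fun _ : Bool => X × T) (i := b)

/-- The canonical map from the free product of two copies of `X × T` to their amalgam. -/
def toAmalgam (r : FreeGroup ℕ →* X) (t : FreeGroup ℕ →* T) :
    CoprodI (fun _ : Bool => X × T) →* PushoutI (amalgamLegs r t) :=
  PushoutI.ofCoprodI

lemma toAmalgam_of (r : FreeGroup ℕ →* X) (t : FreeGroup ℕ →* T) (b : Bool) (a : X × T) :
    toAmalgam r t (copyIncl X T b a) = PushoutI.of (φ := amalgamLegs r t) b a :=
  PushoutI.ofCoprodI_of (φ := amalgamLegs r t) b a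

lemma amalgamLegs_injective (r : FreeGroup ℕ →* X) {t : FreeGroup ℕ →* T}
    (ht : Function.Injective t) (b : Bool) : Function.Injective (amalgamLegs r t b) := by
  intro e e' h
  cases b
  · exact ht (congrArg Prod.snd h)
  · exact ht (congrArg Prod.snd h)

/-- A homomorphism from `X` killing the image of `r` extends to the amalgam. -/
lemma exists_amalgam_extension (r : FreeGroup ℕ →* X) (t : FreeGroup ℕ →* T) {Q : Type*} [Group Q]
    (f : X →* Q) (hf : ∀ e, f (r e) = 1) :
    ∃ F : PushoutI (amalgamLegs r t) →* Q,
      (∀ a : X × T, F (PushoutI.of false a) = f a.1) ∧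
        ∀ a : X × T, F (PushoutI.of true a) = 1 := by
  refine ⟨PushoutI.lift (fun b => match b with
    | false => f.comp (MonoidHom.fst X T)
    | true => 1) 1 ?_, fun a => ?_, fun a => ?_⟩
  · rintro (_ | _)
    · ext i
      simp [amalgamLegs, hf]
    · rfl
  · rw [PushoutI.lift_of]; rfl
  · rw [PushoutI.lift_of]; rfl

variable {ι : Type*} {l : Filter ι} {r : ι → FreeGroup ℕ →* X} {r₀ : FreeGroup ℕ →* X}
  {t : FreeGroup ℕ →* T}

/-- If the relators `r p` tend to `r₀` pointwise, an element of the free product that dies in the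
amalgam attached to `r₀` dies in those attached to `r p` from some point on: such elements form a
normal subgroup containing the relations of the first amalgam. -/
lemma eventually_toAmalgam_eq_one (hr : ∀ e, ∀ᶠ p in l, r p e = r₀ e)
    {g : CoprodI (fun _ : Bool => X × T)} (hg : toAmalgam r₀ t g = 1) :
    ∀ᶠ p in l, toAmalgam (r p) t g = 1 := by
  let K : Subgroup (CoprodI (fun _ : Bool => X × T)) :=
    { carrier := {g | ∀ᶠ p in l, toAmalgam (r p) t g = 1}
      one_mem' := Eventually.of_forall fun p => map_one _
      mul_mem' := fun {a b} ha hb => by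
        filter_upwards [ha, hb] with p h h'
        rw [map_mul, h, h', one_mul]
      inv_mem' := fun {a} ha => by
        filter_upwards [ha] with p h
        rw [map_inv, h, inv_one] }
  have hK : K.Normal := by
    refine ⟨fun a ha b => ?_⟩
    filter_upwards [show ∀ᶠ p in l, toAmalgam (r p) t a = 1 from ha] with p h
    rw [map_mul, map_mul, h, map_inv, mul_one, mul_inv_cancel]
  let F : PushoutI (amalgamLegs r₀ t) →* CoprodI (fun _ : Bool => X × T) ⧸ K :=
    PushoutI.lift (fun b => (QuotientGroup.mk' K).comp (copyIncl X T b))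
      (((QuotientGroup.mk' K).comp (copyIncl X T true)).comp (amalgamLegs r₀ t true)) <| by
      rintro (_ | _)
      · ext e : 1
        refine (QuotientGroup.eq (s := K)).2 ?_
        change ∀ᶠ p in l, toAmalgam (r p) t _ = 1
        filter_upwards [hr (FreeGroup.of e)] with p hp
        have h1 : amalgamLegs r₀ t false (FreeGroup.of e) =
            amalgamLegs (r p) t false (FreeGroup.of e) := by simp [amalgamLegs, hp]
        have h2 : amalgamLegs r₀ t true = amalgamLegs (r p) t true := rfl
        rw [map_mul, map_inv, h1, h2, toAmalgam_of, toAmalgam_of, PushoutI.of_apply_eq_base,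
          PushoutI.of_apply_eq_base, inv_mul_cancel]
      · rfl
  have hF : F.comp (toAmalgam r₀ t) = QuotientGroup.mk' K := by
    refine CoprodI.ext_hom _ _ fun b => ?_
    ext a : 1
    change F (toAmalgam r₀ t (copyIncl X T b a)) = _
    rw [toAmalgam_of, PushoutI.lift_of]
    rfl
  have h := DFunLike.congr_fun hF g
  rw [MonoidHom.comp_apply, hg, map_one] at h
  exact (QuotientGroup.eq_one_iff g).1 h.symm

/-- If the relators `r p` tend to `r₀` pointwise, an element of `X × T` outside a base subgroup of
the amalgam attached to `r₀` is outside that of `r p` from some point on: its second component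
determines the only element of the free group from which it could come. -/
lemma eventually_notMem_range (ht : Function.Injective t) (hr : ∀ e, ∀ᶠ p in l, r p e = r₀ e)
    (b : Bool) {a : X × T} (ha : a ∉ (amalgamLegs r₀ t b).range) :
    ∀ᶠ p in l, a ∉ (amalgamLegs (r p) t b).range := by
  cases b
  · by_cases h : ∃ e, t e = a.2
    · obtain ⟨e, he⟩ := h
      filter_upwards [hr e] with p hp
      rintro ⟨e', rfl⟩
      obtain rfl : e = e' := ht he
      exact ha ⟨e, Prod.ext hp.symm rfl⟩
    · refine Eventually.of_forall fun p => ?_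
      rintro ⟨e, rfl⟩
      exact h ⟨e, rfl⟩
  · exact Eventually.of_forall fun p => ha

/-- If the relators `r p` tend to `r₀` pointwise, then from some point on an element of the free
product is trivial in the amalgam attached to `r p` if and only if it is trivial in the one attached
to `r₀`. An element that is non-trivial in the latter has a reduced form there; from some point on
the element still has this form, and the form is still reduced. -/
theorem eventually_toAmalgam_eq_one_iff (ht : Function.Injective t)
    (hr : ∀ e, ∀ᶠ p in l, r p e = r₀ e) (g : CoprodI (fun _ : Bool => X × T)) :
    ∀ᶠ p in l, toAmalgam (r p) t g = 1 ↔ toAmalgam r₀ t g = 1 := by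
  classical
  by_cases hg : toAmalgam r₀ t g = 1
  · filter_upwards [eventually_toAmalgam_eq_one hr hg] with p hp
    simp [hg, hp]
  obtain ⟨d⟩ := PushoutI.NormalWord.transversal_nonempty _ (amalgamLegs_injective r₀ ht)
  -- The normal form of the element in the amalgam attached to `r₀`.
  let w : PushoutI.NormalWord d := PushoutI.NormalWord.equiv (toAmalgam r₀ t g)
  have hw : PushoutI.base (amalgamLegs r₀ t) w.head * toAmalgam r₀ t w.toWord.prod =
      toAmalgam r₀ t g :=
    PushoutI.NormalWord.equiv.symm_apply_apply (toAmalgam r₀ t g)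
  have hred : PushoutI.Reduced (amalgamLegs r₀ t) w.toWord := by
    rintro ⟨b, a⟩ ha ⟨e, he⟩
    have h1 : a ∈ d.set b := w.normalized b a ha
    have h2 := (d.compl b).injective
      (a₁ := (⟨a, e, he⟩, ⟨1, d.one_mem b⟩)) (a₂ := (⟨1, one_mem _⟩, ⟨a, h1⟩))
      (by simp)
    exact w.ne_one _ ha (congrArg (fun q => (q.1 : X × T)) h2)
  have hred' : ∀ᶠ p in l, PushoutI.Reduced (amalgamLegs (r p) t) w.toWord :=
    (eventually_all_finite w.toList.finite_toSet).2
      fun a ha => eventually_notMem_range ht hr a.1 (hred a ha)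
  -- The head comes from the second copy of `X × T`, where the base does not depend on the relators,
  -- so one element of the free product expresses the normal form for all relators at once.
  have hform : ∀ p : FreeGroup ℕ →* X,
      toAmalgam p t (copyIncl X T true (amalgamLegs p t true w.head) * w.toWord.prod * g⁻¹) =
      PushoutI.base (amalgamLegs p t) w.head * toAmalgam p t w.toWord.prod *
        (toAmalgam p t g)⁻¹ := by
    intro p
    rw [map_mul, map_mul, map_inv, toAmalgam_of, PushoutI.of_apply_eq_base]
  have hone := eventually_toAmalgam_eq_one (t := t) hr
    ((hform r₀).trans (by rw [hw, mul_inv_cancel]))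
  filter_upwards [hred', hone] with p hp hp'
  have hp'' := (hform (r p)).symm.trans hp'
  refine iff_of_false (fun h => hg ?_) hg
  rw [h, inv_one, mul_one] at hp''
  have hempty : w.toWord = .empty := by
    refine hp.eq_empty_of_mem_range (amalgamLegs_injective (r p) ht) ⟨w.head⁻¹, ?_⟩
    rw [map_inv]
    exact inv_eq_of_mul_eq_one_right hp''
  rw [hempty, CoprodI.Word.prod_empty, map_one, mul_one] at hp''
  have hhead : w.head = 1 :=
    PushoutI.base_injective (amalgamLegs_injective (r p) ht) (hp''.trans (map_one _).symm)
  rw [← hw, hempty, hhead, CoprodI.Word.prod_empty, map_one, map_one, mul_one]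

end Amalgam

/-! ### The marked group attached to a sequence of relators -/

section MarkedAmalgam

open Monoid

variable {T : Type} [Group T] {k m : ℕ} (π : FreeGroup (Fin m) →* T)

/-- The homomorphism to the free product of two copies of `FreeGroup (Fin k) × T` that sends the
first `k` generators to those of the first copy of the free group, and the following `m + m` ones
to the generators of the first and of the second copy of `T`. -/
def amalgamMarking (k : ℕ) :
    FreeGroup (Fin (k + (m + m))) →* CoprodI (fun _ : Bool => FreeGroup (Fin k) × T) :=
  FreeGroup.lift (Fin.addCases
    (fun i => copyIncl (FreeGroup (Fin k)) T false
      (FreeGroup.of i, 1))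
    (Fin.addCases
      (fun j => copyIncl (FreeGroup (Fin k)) T false
        (1, π (FreeGroup.of j)))
      (fun j => copyIncl (FreeGroup (Fin k)) T true
        (1, π (FreeGroup.of j)))))

/-- The inclusion of the free group on the first `k` generators. -/
def firstGens (k n : ℕ) : FreeGroup (Fin k) →* FreeGroup (Fin (k + n)) :=
  FreeGroup.map (Fin.castAdd n)

lemma amalgamMarking_firstGens (g : FreeGroup (Fin k)) :
    amalgamMarking π k (firstGens k (m + m) g) =
      copyIncl (FreeGroup (Fin k)) T false (g, 1) := by
  refine DFunLike.congr_fun (f := (amalgamMarking π k).comp (firstGens k (m + m)))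
    (g := (copyIncl _ _ false).comp (MonoidHom.inl (FreeGroup (Fin k)) T)) ?_ g
  ext i
  simp [amalgamMarking, firstGens]

lemma amalgamMarking_middleGens (v : FreeGroup (Fin m)) :
    amalgamMarking π k (FreeGroup.map (fun j => Fin.natAdd k (Fin.castAdd m j)) v) =
      copyIncl (FreeGroup (Fin k)) T false (1, π v) := by
  refine DFunLike.congr_fun
    (f := (amalgamMarking π k).comp (FreeGroup.map fun j => Fin.natAdd k (Fin.castAdd m j)))
    (g := ((copyIncl _ _ false).comp (MonoidHom.inr (FreeGroup (Fin k)) T)).comp π) ?_ v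
  ext i
  simp [amalgamMarking]

lemma amalgamMarking_lastGens (v : FreeGroup (Fin m)) :
    amalgamMarking π k (FreeGroup.map (fun j => Fin.natAdd k (Fin.natAdd m j)) v) =
      copyIncl (FreeGroup (Fin k)) T true (1, π v) := by
  refine DFunLike.congr_fun
    (f := (amalgamMarking π k).comp (FreeGroup.map fun j => Fin.natAdd k (Fin.natAdd m j)))
    (g := ((copyIncl _ _ true).comp (MonoidHom.inr (FreeGroup (Fin k)) T)).comp π) ?_ v
  ext i
  simp [amalgamMarking, -Fin.natAdd_eq_addNat]

/-- The sum of a positive and of a non-negative integer, as a positive integer. -/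
abbrev addRank (k : ℕ+) (n : ℕ) : ℕ+ := ⟨k + n, Nat.add_pos_left k.pos n⟩

/-- The marked group generated by `k + (m + m)` elements of the amalgam attached to the relators
`r` in the free group of rank `k`. -/
def markedAmalgam (k : ℕ+) (r : FreeGroup ℕ →* FreeGroup (Fin k)) (t : FreeGroup ℕ →* T) :
    MarkedGroup where
  rank := addRank k (m + m)
  rel := ((toAmalgam r t).comp (amalgamMarking π k)).ker
  normal := MonoidHom.normal_ker _

/-- A homomorphism to a group `Q` to which `T` has no non-trivial homomorphism, if it respects the
relations of the marked amalgam, kills the last `m + m` generators and the relators. -/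
lemma killed_of_markedAmalgam {k : ℕ+} {r : FreeGroup ℕ →* FreeGroup (Fin k)}
    {t : FreeGroup ℕ →* T} (hπ : Function.Surjective π) {Q : Type*} [Group Q]
    (hT : ∀ (f : T →* Q) (x : T), f x = 1) (f : FreeGroup (Fin (k + (m + m))) →* Q)
    (hf : ((toAmalgam r t).comp (amalgamMarking π k)).ker ≤ f.ker) :
    (∀ j : Fin (m + m), f (FreeGroup.of (Fin.natAdd k j)) = 1) ∧
      ∀ e, f (firstGens k (m + m) (r e)) = 1 := by
  have key : ∀ i : FreeGroup (Fin m) →* FreeGroup (Fin (k + (m + m))),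
      (∀ v, π v = 1 → amalgamMarking π k (i v) = 1) → ∀ v, f (i v) = 1 := by
    intro i hi v
    have hker : π.ker ≤ (f.comp i).ker := fun v hv => hf <| by
      rw [MonoidHom.mem_ker, MonoidHom.comp_apply, hi v hv, map_one]
    have := hT (π.liftOfSurjective hπ ⟨f.comp i, hker⟩) (π v)
    rwa [MonoidHom.liftOfSurjective, MonoidHom.liftOfRightInverse_comp_apply] at this
  have hmid := key (FreeGroup.map fun j => Fin.natAdd k (Fin.castAdd m j)) fun v hv => by
    rw [amalgamMarking_middleGens, hv]; exact map_one _
  have hlast := key (FreeGroup.map fun j => Fin.natAdd k (Fin.natAdd m j)) fun v hv => by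
    rw [amalgamMarking_lastGens, hv]; exact map_one _
  refine ⟨fun j => ?_, fun e => ?_⟩
  · refine Fin.addCases (fun j => ?_) (fun j => ?_) j
    · simpa using hmid (FreeGroup.of j)
    · simpa using hlast (FreeGroup.of j)
  · obtain ⟨v, hv⟩ := hπ (t e)
    have hrel : firstGens k (m + m) (r e) *
        FreeGroup.map (fun j => Fin.natAdd k (Fin.castAdd m j)) v *
        (FreeGroup.map (fun j => Fin.natAdd k (Fin.natAdd m j)) v)⁻¹ ∈ f.ker := by
      refine hf ?_
      rw [MonoidHom.mem_ker, MonoidHom.comp_apply, map_mul (amalgamMarking π k),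
        map_mul (amalgamMarking π k), map_inv (amalgamMarking π k),
        amalgamMarking_firstGens, amalgamMarking_middleGens, amalgamMarking_lastGens, hv,
        ← map_mul, map_mul, map_inv, toAmalgam_of, toAmalgam_of]
      have h1 : ((r e, 1) * (1, t e) : FreeGroup (Fin k) × T) = amalgamLegs r t false e := by
        simp [amalgamLegs]
      have h2 : ((1, t e) : FreeGroup (Fin k) × T) = amalgamLegs r t true e := rfl
      rw [h1, h2, PushoutI.of_apply_eq_base, PushoutI.of_apply_eq_base, mul_inv_cancel]
    rwa [MonoidHom.mem_ker, map_mul, map_mul, map_inv, hmid, hlast, inv_one, mul_one,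
      mul_one] at hrel

lemma mem_residualImage_rel (C : Set GrpCat.{u}) (G : MarkedGroup) (g : FreeGroup (Fin G.rank)) :
    g ∈ (residualImage C G).rel ↔ ∀ Q ∈ C, ∀ f : FreeGroup (Fin G.rank) →* Q,
      Function.Surjective f → G.rel ≤ f.ker → f g = 1 := by
  change (QuotientGroup.mk' G.rel g) ∈ residualKernel C G.group ↔ _
  simp only [residualKernel, Subgroup.mem_iInf, MonoidHom.mem_ker]
  constructor
  · intro h Q hQ f hf hle
    exact h Q hQ (QuotientGroup.lift G.rel f hle)
      (QuotientGroup.lift_surjective_of_surjective _ f hf hle)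
  · intro h Q hQ f hf
    refine h Q hQ (f.comp (QuotientGroup.mk' G.rel))
      (hf.comp (QuotientGroup.mk'_surjective _)) fun x hx => ?_
    rw [MonoidHom.mem_ker, MonoidHom.comp_apply, QuotientGroup.mk'_apply,
      (QuotientGroup.eq_one_iff x).2 hx, map_one]

/-- If `T` has no non-trivial homomorphism to groups of `C`, the marked amalgam attached to a
presentation of `G` has the same quotients in `C` as `G`. -/
theorem firstGens_mem_residualImage_iff {C : Set GrpCat.{u}} (hπ : Function.Surjective π)
    (hT : ∀ Q ∈ C, ∀ (f : T →* Q) (x : T), f x = 1) (t : FreeGroup ℕ →* T) (G : MarkedGroup)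
    (r : FreeGroup ℕ →* FreeGroup (Fin G.rank))
    (hG : G.rel = Subgroup.normalClosure (Set.range fun i => r (FreeGroup.of i)))
    (g : FreeGroup (Fin G.rank)) :
    firstGens G.rank (m + m) g ∈ (residualImage C (markedAmalgam π G.rank r t)).rel ↔
      g ∈ (residualImage C G).rel := by
  rw [mem_residualImage_rel C G]
  refine (mem_residualImage_rel C (markedAmalgam π G.rank r t) _).trans ?_
  constructor
  · intro h Q hQ f hf hle
    have hfr : ∀ e, f (r e) = 1 := by
      refine DFunLike.congr_fun (f := f.comp r) (g := 1) ?_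
      ext i
      refine hle ?_
      rw [hG]
      exact Subgroup.subset_normalClosure ⟨i, rfl⟩
    obtain ⟨F, hF, -⟩ := exists_amalgam_extension r t f hfr
    have hfirst : ∀ x, F (toAmalgam r t (amalgamMarking π G.rank
        (firstGens G.rank (m + m) x))) = f x := by
      intro x
      rw [amalgamMarking_firstGens, toAmalgam_of, hF]
    rw [← hfirst]
    refine h Q hQ (F.comp ((toAmalgam r t).comp (amalgamMarking π G.rank))) ?_ ?_
    · intro q
      obtain ⟨x, rfl⟩ := hf q
      exact ⟨_, hfirst x⟩
    · intro x hx
      exact (congrArg F (MonoidHom.mem_ker.1 hx)).trans (map_one F)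
  · intro h Q hQ (f : FreeGroup (Fin (G.rank + (m + m))) →* Q) hf hle
    obtain ⟨hgens, hrel⟩ := killed_of_markedAmalgam π hπ (hT Q hQ) f hle
    refine h Q hQ (f.comp (firstGens G.rank (m + m))) ?_ ?_
    -- `f` factors through the retraction to the first generators, as it kills the other ones.
    · let ret : FreeGroup (Fin (G.rank + (m + m))) →* FreeGroup (Fin G.rank) :=
        FreeGroup.lift (Fin.addCases FreeGroup.of fun _ => 1)
      have hret : (f.comp (firstGens G.rank (m + m))).comp ret = f := by
        refine FreeGroup.ext_hom _ _ fun i => ?_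
        refine Fin.addCases (fun i => ?_) (fun j => ?_) i
        · simp [ret, firstGens]
        · rw [hgens]
          simp [ret]
      intro q
      obtain ⟨x, rfl⟩ := hf q
      exact ⟨ret x, DFunLike.congr_fun hret x⟩
    · rw [hG]
      refine Subgroup.normalClosure_le_normal ?_
      rintro _ ⟨i, rfl⟩
      exact hrel _

end MarkedAmalgam

/-! ### Continuity of the reductions -/

section Names

open Filter Topology

lemma eventually_apply_eq (u : Baire) (n : ℕ) : ∀ᶠ u' in 𝓝 u, u' n = u n :=
  (continuous_apply n).continuousAt.eventually
    (mem_nhds_discrete.2 (rfl : u n = u n) : ∀ᶠ k in 𝓝 (u n), k = u n)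

lemma continuous_of_eventually_eq {F : Baire → Baire}
    (h : ∀ u n, ∀ᶠ u' in 𝓝 u, F u' n = F u n) : Continuous F :=
  continuous_pi fun n => continuous_iff_continuousAt.2 fun u =>
    continuousAt_const.congr ((h u n).mono fun _ hu => hu.symm)

/-- The one point represented space, of which every sequence is a name. -/
def pointSpace : RepresentedSpace where
  carrier := Unit
  IsName _ _ := True
  functional _ _ _ _ _ := rfl
  surjective _ := ⟨0, trivial⟩

/-- The name, with even part `0`, of a pair with second component named by `v`. -/
def pairName (v : Baire) : Baire := fun n => if n % 2 = 0 then 0 else v (n / 2)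

lemma pairName_odd (v : Baire) : (fun n => pairName v (2 * n + 1)) = v := by
  ext n
  have h0 : ¬ (2 * n + 1) % 2 = 0 := by omega
  have h1 : (2 * n + 1) / 2 = n := by omega
  simp only [pairName, if_neg h0, h1]

lemma pairName_isName {X : RepresentedSpace} {v : Baire} {x : X.carrier} (h : X.IsName v x)
    (a : Unit) : (pointSpace.prod X).IsName (pairName v) (a, x) := by
  refine ⟨trivial, ?_⟩
  change X.IsName (fun n => pairName v (2 * n + 1)) x
  rwa [pairName_odd]

lemma continuous_pairName {F : Baire → Baire} (h : ∀ u n, ∀ᶠ u' in 𝓝 u, F u' n = F u n) :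
    Continuous fun u => pairName (F u) := by
  refine continuous_of_eventually_eq fun u n => ?_
  filter_upwards [h u (n / 2)] with u' hu'
  simp only [pairName, hu']

namespace Problem

variable {X Y Z W V : RepresentedSpace}

/-- To solve a function `p` through a function `q`, it is enough that, for all values `z` of the
preprocessing, the postprocessing returns exactly `p x` from `q z`. -/
lemma solves_ofFun {p : X.carrier → Y.carrier} {q : Z.carrier → W.carrier}
    {h : Problem (V.prod W) Y} {k : Problem X (V.prod Z)} (hk : ∀ x, (k x).Nonempty)
    (hh : ∀ x, ∀ z ∈ k x, h (z.1, q z.2) = {p x}) :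
    Solves (h.comp (((ident V).prod (ofFun q)).comp k)) (ofFun p) := by
  have hval : ∀ x, ∀ y ∈ (((ident V).prod (ofFun q)).comp k) x, h y = {p x} := by
    rintro x ⟨v, w⟩ ⟨-, z, hz, hv, hw⟩
    obtain rfl : v = z.1 := hv
    obtain rfl : w = q z.2 := hw
    exact hh x z hz
  refine ⟨fun x _ => ⟨p x, fun y hy => ?_, ?_⟩, ?_⟩
  · rw [dom, Set.mem_ofPred_eq, hval x y hy]
    exact Set.singleton_nonempty _
  · obtain ⟨z, hz⟩ := hk x
    exact ⟨(z.1, q z.2), ⟨fun y _ => ⟨(y.1, q y.2), rfl, rfl⟩, z, hz, rfl, rfl⟩,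
      by rw [hh x z hz]; rfl⟩
  · rintro x - y ⟨-, z, hz, hy⟩
    rw [hval x z hz] at hy
    exact hy

end Problem

variable {θ : ∀ k : ℕ+, ℕ ≃ FreeGroup (Fin k)}

lemma markedGroupsWP_isName_iff {u : Baire} {G : MarkedGroup} :
    (markedGroupsWP θ).IsName u G ↔ u 0 = G.rank ∧ (∀ i, u (i + 1) = 0 ∨ u (i + 1) = 1) ∧
      ∀ i, u (i + 1) = 1 ↔ θ G.rank i ∈ G.rel := by
  refine and_congr_right fun _ => and_congr_right fun _ => ?_
  rw [Set.ext_iff]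
  constructor
  · intro h i
    refine Iff.trans ⟨fun hi => ⟨i, hi, rfl⟩, ?_⟩ (h _).symm
    rintro ⟨j, hj, hji⟩
    rwa [(θ G.rank).injective hji] at hj
  · intro h g
    obtain ⟨i, rfl⟩ := (θ G.rank).surjective g
    refine (h i).symm.trans ⟨fun hi => ⟨i, hi, rfl⟩, ?_⟩
    rintro ⟨j, hj, hji⟩
    rwa [(θ G.rank).injective hji] at hj

variable (θ)

open Classical in
/-- The name of a marked group in the word problem representation. -/
noncomputable def wpName (G : MarkedGroup) : Baire
  | 0 => G.rank
  | i + 1 => if θ G.rank i ∈ G.rel then 1 else 0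

lemma wpName_zero (G : MarkedGroup) : wpName θ G 0 = G.rank := rfl

open Classical in
lemma wpName_succ (G : MarkedGroup) (i : ℕ) :
    wpName θ G (i + 1) = if θ G.rank i ∈ G.rel then 1 else 0 := rfl

lemma wpName_isName (G : MarkedGroup) : (markedGroupsWP θ).IsName (wpName θ G) G := by
  refine markedGroupsWP_isName_iff.2 ⟨rfl, fun i => ?_, fun i => ?_⟩ <;>
    by_cases h : θ G.rank i ∈ G.rel <;> simp [wpName, h]

/-- The enumeration of relators obtained from the characteristic function of the relations of a
group of rank `k`: the trivial relator stands in for the elements that are not relations. -/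
def relatorName (k : ℕ+) (u : Baire) : Baire
  | 0 => u 0
  | i + 1 => if u (i + 1) = 1 then i else (θ k).symm 1

lemma relatorName_isName {u : Baire} {G : MarkedGroup} (h : (markedGroupsWP θ).IsName u G) :
    (markedGroupsPres θ).IsName (relatorName θ (u 0).toPNat' u) G := by
  obtain ⟨h0, -, h1⟩ := markedGroupsWP_isName_iff.1 h
  have hk : (u 0).toPNat' = G.rank := by rw [h0]; exact PNat.coe_toPNat' _
  rw [hk]
  refine ⟨h0, le_antisymm (fun g hg => ?_) (Subgroup.normalClosure_le_normal ?_)⟩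
  · obtain ⟨i, rfl⟩ := (θ G.rank).surjective g
    refine Subgroup.subset_normalClosure ⟨i, ?_⟩
    simp [relatorName, (h1 i).2 hg]
  · rintro _ ⟨i, rfl⟩
    by_cases hi : u (i + 1) = 1
    · simpa [relatorName, hi] using (h1 i).1 hi
    · simp [relatorName, hi]

/-- The word problem representation refines the presentation representation. -/
lemma weihrauchLE_wp_pres (p : MarkedGroup → MarkedGroup) :
    Problem.WeihrauchLE
      (Problem.ofFun p : Problem (markedGroupsWP θ) (markedGroupsWP θ))
      (Problem.ofFun p : Problem (markedGroupsPres θ) (markedGroupsWP θ)) := by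
  refine ⟨pointSpace, fun z => {z.2}, fun G => {((), G)},
    ⟨Set.univ, fun u n => u (2 * n + 1), ?_, ?_⟩,
    ⟨Set.univ, fun u => pairName (relatorName θ (u 0).toPNat' u), ?_, ?_⟩,
    Problem.solves_ofFun (fun G => Set.singleton_nonempty _) ?_⟩
  · exact (continuous_of_eventually_eq fun u n => eventually_apply_eq u _).continuousOn
  · exact fun u z hu _ => ⟨trivial, z.2, rfl, hu.2⟩
  · refine (continuous_pairName fun u n => ?_).continuousOn
    cases n with
    | zero => exact eventually_apply_eq u 0
    | succ n =>
      filter_upwards [eventually_apply_eq u 0, eventually_apply_eq u (n + 1)] with u' h h'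
      change (if u' (n + 1) = 1 then n else (θ (u' 0).toPNat').symm 1) = _
      rw [h, h']
      rfl
  · exact fun u G hu _ => ⟨trivial, ((), G), rfl, pairName_isName (relatorName_isName θ hu) ()⟩
  · rintro G _ rfl
    rfl

/-- The homomorphism from the free group on `ℕ` given by the relators enumerated by `u`. -/
def relatorHom (k : ℕ+) (u : Baire) : FreeGroup ℕ →* FreeGroup (Fin k) :=
  FreeGroup.lift fun i => θ k (u (i + 1))

lemma eventually_relatorHom_eq (k : ℕ+) (u : Baire) (e : FreeGroup ℕ) :
    ∀ᶠ u' in 𝓝 u, relatorHom θ k u' e = relatorHom θ k u e := by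
  induction e using FreeGroup.induction_on with
  | C1 => simp
  | of i =>
    filter_upwards [eventually_apply_eq u (i + 1)] with u' h
    simp [relatorHom, h]
  | inv_of i h =>
    filter_upwards [h] with u' h
    rw [map_inv, map_inv, h]
  | mul a b ha hb =>
    filter_upwards [ha, hb] with u' ha hb
    rw [map_mul, map_mul, ha, hb]

variable {T : Type} [Group T] {m : ℕ} (π : FreeGroup (Fin m) →* T) (t : FreeGroup ℕ →* T)

open Classical in
/-- The word problem of the marked amalgam depends continuously on the sequence of relators. -/
lemma eventually_wpName_markedAmalgam_eq (ht : Function.Injective t) (k : ℕ+) (u : Baire) (n : ℕ) :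
    ∀ᶠ u' in 𝓝 u, wpName θ (markedAmalgam π k (relatorHom θ k u') t) n =
      wpName θ (markedAmalgam π k (relatorHom θ k u) t) n := by
  cases n with
  | zero => simp only [wpName_zero, markedAmalgam, eventually_const]
  | succ i =>
    filter_upwards [eventually_toAmalgam_eq_one_iff ht (eventually_relatorHom_eq θ k u)
      (amalgamMarking π k (θ (addRank k (m + m)) i))] with u' h
    rw [wpName_succ, wpName_succ]
    exact if_congr h rfl rfl

/-- The relation between a marked group of rank `k + n` and the subgroup generated by its first `k`
generators. -/
def IsFirstGensOf (n : ℕ) (G G' : MarkedGroup) : Prop :=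
  ∃ h : (G.rank : ℕ) + n = G'.rank,
    G.rel = G'.rel.comap (FreeGroup.map (Fin.cast h ∘ Fin.castAdd n))

lemma IsFirstGensOf.unique {n : ℕ} {G₁ G₂ G' : MarkedGroup} (h₁ : IsFirstGensOf n G₁ G')
    (h₂ : IsFirstGensOf n G₂ G') : G₁ = G₂ := by
  obtain ⟨k₁, N₁, hN₁⟩ := G₁
  obtain ⟨k₂, N₂, hN₂⟩ := G₂
  obtain ⟨e₁, h₁⟩ := h₁
  obtain ⟨e₂, h₂⟩ := h₂
  obtain rfl : k₁ = k₂ := PNat.coe_injective (Nat.add_right_cancel (e₁.trans e₂.symm))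
  obtain rfl : N₁ = N₂ := h₁.trans h₂.symm
  rfl

/-- The name of the subgroup generated by the first `k` generators, computed from a name `q` of
a marked group of rank `k + n`. -/
def firstGensName (n : ℕ) (k : ℕ+) (q : Baire) : Baire
  | 0 => q 0 - n
  | i + 1 => q ((θ (addRank k n)).symm (firstGens k n (θ k i)) + 1)

lemma firstGensName_isName {n : ℕ} {q : Baire} {G G' : MarkedGroup} (hG : IsFirstGensOf n G G')
    (hq : (markedGroupsWP θ).IsName q G') :
    (markedGroupsWP θ).IsName (firstGensName θ n (q 0 - n).toPNat' q) G := by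
  obtain ⟨k, N, hN⟩ := G
  obtain ⟨k', N', hN'⟩ := G'
  obtain ⟨e, h⟩ := hG
  obtain rfl : addRank k n = k' := PNat.coe_injective e
  obtain ⟨h0, h1, h2⟩ := markedGroupsWP_isName_iff.1 hq
  have h0' : q 0 - n = k := by rw [h0]; exact Nat.add_sub_cancel _ _
  rw [h0', PNat.coe_toPNat']
  refine markedGroupsWP_isName_iff.2 ⟨h0', fun i => h1 _, fun i => ?_⟩
  refine (h2 _).trans ((Iff.of_eq (congrArg (· ∈ N') ?_)).trans
    (Iff.of_eq (congrArg (θ k i ∈ ·) h)).symm)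
  exact (θ (addRank k n)).apply_symm_apply (firstGens k n (θ k i))

/-- A reduction of the presentation representation to the word problem representation, given by a
finitely generated group `T` that has no non-trivial homomorphism to a group of `C` and contains a
free subgroup of infinite rank. -/
lemma weihrauchLE_pres_wp {C : Set GrpCat.{u}} (hπ : Function.Surjective π)
    (ht : Function.Injective t) (hT : ∀ Q ∈ C, ∀ (f : T →* Q) (x : T), f x = 1) :
    Problem.WeihrauchLE
      (Problem.ofFun (residualImage C) : Problem (markedGroupsPres θ) (markedGroupsWP θ))
      (Problem.ofFun (residualImage C) : Problem (markedGroupsWP θ) (markedGroupsWP θ)) := by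
  let A : Baire → MarkedGroup := fun u =>
    markedAmalgam π (u 0).toPNat' (relatorHom θ (u 0).toPNat' u) t
  refine ⟨pointSpace, fun z => {G | IsFirstGensOf (m + m) G z.2},
    fun G => {z | ∃ u, (markedGroupsPres θ).IsName u G ∧ z.2 = A u},
    -- The entry `p 1` is the first one of the odd part of `p`, that is, the rank of the amalgam.
    ⟨Set.univ, fun p => firstGensName θ (m + m) (p 1 - (m + m)).toPNat' fun n => p (2 * n + 1),
      ?_, ?_⟩,
    ⟨Set.univ, fun u => pairName (wpName θ (A u)), ?_, ?_⟩,
    Problem.solves_ofFun (fun G => ?_) ?_⟩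
  · refine (continuous_of_eventually_eq fun p n => ?_).continuousOn
    cases n with
    | zero =>
      filter_upwards [eventually_apply_eq p 1] with p' h
      simp [firstGensName, h]
    | succ i =>
      filter_upwards [eventually_apply_eq p 1, eventually_apply_eq p
        (2 * ((θ (addRank (p 1 - (m + m)).toPNat' (m + m))).symm
          (firstGens _ (m + m) (θ (p 1 - (m + m)).toPNat' i)) + 1) + 1)] with p' h h'
      rw [h]
      exact h'
  · rintro p z hp ⟨G, hG⟩
    exact ⟨trivial, G, hG, firstGensName_isName θ hG hp.2⟩
  · refine (continuous_pairName fun u n => ?_).continuousOn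
    -- Near `u` the first entry, hence the rank, is constant.
    filter_upwards [eventually_apply_eq u 0,
      eventually_wpName_markedAmalgam_eq θ π t ht (u 0).toPNat' u n] with u' h h'
    simp only [A]
    rw [h]
    exact h'
  · exact fun u G hu _ => ⟨trivial, ((), A u), ⟨u, hu, rfl⟩, pairName_isName (wpName_isName θ _) ()⟩
  · obtain ⟨u, hu⟩ := (markedGroupsPres θ).surjective G
    exact ⟨((), A u), u, hu, rfl⟩
  · rintro G ⟨-, _⟩ ⟨u, hu, rfl⟩
    have hk : (u 0).toPNat' = G.rank := by rw [hu.1]; exact PNat.coe_toPNat' _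
    have hA : A u = markedAmalgam π G.rank (relatorHom θ G.rank u) t := by
      simp only [A]
      rw [hk]
    have hG : IsFirstGensOf (m + m) (residualImage C G) (residualImage C (A u)) := by
      rw [hA]
      refine ⟨rfl, ?_⟩
      ext g
      refine (firstGens_mem_residualImage_iff π hπ hT t G (relatorHom θ G.rank u) ?_ g).symm
      rw [hu.2]
      simp only [relatorHom, FreeGroup.lift_apply_of]
    ext G'
    exact ⟨fun h => h.unique hG, fun h => (show G' = residualImage C G from h) ▸ hG⟩

end Names

theorem mainTheorem10 (θ : ∀ k : ℕ+, ℕ ≃ FreeGroup (Fin k))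
    (C : Set GrpCat.{u}) (hfg : ∀ Q ∈ C, Group.FG Q)
    (hnontriv : ResiduallyNontrivial C)
    (hsep : ∃ (H : MarkedGroup) (w : H.group), w ≠ 1 ∧
      ∀ Q ∈ C, ∀ f : H.group →* Q, f w = 1) :
    Problem.WeihrauchEquiv
      (Problem.ofFun (residualImage C) : Problem (markedGroupsWP θ) (markedGroupsWP θ))
      (Problem.ofFun (residualImage C) : Problem (markedGroupsPres θ) (markedGroupsWP θ)) := by
  obtain ⟨H, w, hw, hC⟩ := hsep
  obtain ⟨T, _, hT, t, ht, hkill⟩ := exists_fg_killed_free C H.group hw hC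
  obtain ⟨α, _, ψ, hψ⟩ := Group.fg_iff_exists_freeGroup_hom_surjective_finite.1 hT
  obtain ⟨m, ⟨e⟩⟩ := Finite.exists_equiv_fin α
  have hπ := hψ.comp (FreeGroup.freeGroupCongr e.symm).surjective
  exact ⟨weihrauchLE_wp_pres θ _, weihrauchLE_pres_wp θ
    (ψ.comp (FreeGroup.freeGroupCongr e.symm).toMonoidHom) t hπ ht hkill⟩
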